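/- Fix a finite set $K$ of time slots. Consider the $2|K|$ signal modes $(p,k)$, $p\in\{0,1\}$, $k\in K$ (port $p$, time slot $k$) and, for every signal mode $s$, a loss mode $T_s$; write $\mathcal F$ for the bosonic Fock space of the signal modes and $|{\rm vac}\rangle$ for the vacuum of the loss modes. All operators below are the unitaries on the Fock space of signal and loss modes that fix the vacuum and implement the stated transformation of creation operators. * For $\eta\in[0,1]$, $\hat U_\eta$ is the $\eta$-beam splitter acting in every time slot: $\hat a^\dagger_{0,k}\mapsto\sqrt{1-\eta}\,\hat a^\dagger_{0,k}+\sqrt{\eta}\,\hat a^\dagger_{1,k}$ and $\hat a^\dagger_{1,k}\mapsto\sqrt{\eta}\,\hat a^\dagger_{0,k}-\sqrt{1-\eta}\,\hat a^\dagger_{1,k}$, the loss modes being left alone. * $\hat U_{\rm det}$ consists of the loss beam splitters that model detectors of common efficiency $\eta_{\rm det}\in[0,1]$: $\hat a^\dagger_s\mapsto\sqrt{\eta_{\rm det}}\,\hat a^\dagger_s+\sqrt{1-\eta_{\rm det}}\,\hat a^\dagger_{T_s}$ and $\hat a^\dagger_{T_s}\mapsto\sqrt{\eta_{\rm det}}\,\hat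 a^\dagger_{T_s}-\sqrt{1-\eta_{\rm det}}\,\hat a^\dagger_s$ for every signal mode $s$. * $\hat D_\sigma$ is the delay line in arm $0$: $\hat a^\dagger_{0,k}\mapsto\hat a^\dagger_{0,\sigma(k)}$ for a permutation $\sigma$ of $K$, all other modes being left alone (a delay by one slot is the cyclic shift, with the last slot initially empty; $\sigma=1$ is no delay). * $\hat U_{\rm MZ}=\hat U_{\eta_2}\hat D_\sigma\hat U_{\eta_1}$ is the Mach-Zehnder interferometer whose two beam splitters have transmittances $\eta_1,\eta_2\in[0,1]$ (in particular, $\eta_i\in[1/2-\delta_i,1/2+\delta_i]$ with $0\le\delta_i<1/2$ is covered). Let ${\rm tr}_T$ be the partial trace over all loss modes and $\hat P(\Psi)=|\Psi\rangle\langle\Psi|$. Then for all $\eta,\eta_1,\eta_2,\eta_{\rm det}\in[0,1]$ and every permutation $\sigma$ of $K$: 1. for every $\psi\in\mathcal F$, ${\rm tr}_T\,\hat P(\hat U_\eta\hat U_{\rm det}|\psi\rangle|{\rm vac}\rangle)={\rm tr}_T\,\hat P(\hat U_{\rm det}\hat U_\eta|\psi\rangle|{\rm vac}\rangle)$; 2.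 for every $\phi\in\mathcal F$, ${\rm tr}_T\,\hat P(\hat U_{\rm det}\hat U_{\rm MZ}|\phi\rangle|{\rm vac}\rangle)={\rm tr}_T\,\hat P(\hat U_{\rm MZ}\hat U_{\rm det}|\phi\rangle|{\rm vac}\rangle)$. That is, the beam splitters modelling the detection inefficiency can be moved from in front of the detectors to in front of the Mach-Zehnder interferometer without changing the state that reaches the detectors. -/

import Mathlib

namespace BosonicOptics

/-- The bosonic Fock space of the optical modes labelled by `ι`: square-summable amplitudes on the
photon-number (Fock) basis `|n⟩`, `n : ι → ℕ`. The norm is the usual Hilbert space norm. -/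
abbrev Fock (ι : Type*) : Type _ := lp (fun _ : ι → ℕ => ℂ) 2

set_option linter.unusedSectionVars false
section amplitudes
variable {ι : Type*} [Fintype ι] [DecidableEq ι]

/-- `∏ i, (∑ j, V j i a†_j) ^ (m i)` as a polynomial in the commuting creation operators, where the
variable `X j` stands for `a†_j`. -/
noncomputable def creationPoly (V : Matrix ι ι ℂ) (m : ι → ℕ) : MvPolynomial ι ℂ :=
  ∏ i, (∑ j, MvPolynomial.C (V j i) * MvPolynomial.X j) ^ m i

/-- The matrix element `⟨n| Γ(V) |m⟩` of the linear-optics transformation `a†_i ↦ ∑ j, V j i a†_j`,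
`|vac⟩ ↦ |vac⟩`. Since `|m⟩ = ∏ i, (a†_i) ^ (m i) / √(m i)! |vac⟩`, the image of `|m⟩` is
`∏ i, (∑ j, V j i a†_j) ^ (m i) |vac⟩ / √(∏ i, (m i)!)`, and the monomial `∏ j, (a†_j) ^ (n j)`
applied to `|vac⟩` is `√(∏ j, (n j)!) |n⟩`. -/
noncomputable def amplitude (V : Matrix ι ι ℂ) (n m : ι → ℕ) : ℂ :=
  ((√((∏ i, (n i).factorial : ℕ) : ℝ) / √((∏ i, (m i).factorial : ℕ) : ℝ) : ℝ) : ℂ) *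
    MvPolynomial.coeff (Finsupp.equivFunOnFinite.symm n) (creationPoly V m)

/-- The Fock basis labels with `N` photons in total. -/
abbrev sector (ι : Type*) [Fintype ι] [DecidableEq ι] (N : ℕ) : Finset (ι → ℕ) :=
  Finset.piAntidiag Finset.univ N

/-- The linear-optics transformation on amplitudes. It preserves the total photon number, so every
output amplitude is a finite sum. -/
noncomputable def fockAction (V : Matrix ι ι ℂ) (ψ : (ι → ℕ) → ℂ) (n : ι → ℕ) : ℂ :=
  ∑ m ∈ sector ι (∑ i, n i), amplitude V n m * ψ m

theorem mem_sector {N : ℕ} {n : ι → ℕ} : n ∈ sector ι N ↔ ∑ i, n i = N := by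
  simp

theorem creationPoly_isHomogeneous (V : Matrix ι ι ℂ) (m : ι → ℕ) :
    (creationPoly V m).IsHomogeneous (∑ i, m i) := by
  unfold creationPoly
  refine MvPolynomial.IsHomogeneous.prod _ _ _ fun i _ => ?_
  have h : (∑ j, MvPolynomial.C (V j i) * MvPolynomial.X j :
      MvPolynomial ι ℂ).IsHomogeneous 1 :=
    MvPolynomial.IsHomogeneous.sum _ _ _ fun j _ => MvPolynomial.isHomogeneous_C_mul_X _ _
  simpa using h.pow (m i)

theorem creationPoly_mul (V W : Matrix ι ι ℂ) (m : ι → ℕ) :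
    creationPoly (V * W) m = MvPolynomial.aeval
      (fun j => ∑ l, MvPolynomial.C (V l j) * MvPolynomial.X l : ι → MvPolynomial ι ℂ)
      (creationPoly W m) := by
  unfold creationPoly
  simp only [map_prod, map_pow, map_sum, map_mul, MvPolynomial.aeval_X, MvPolynomial.algHom_C,
    MvPolynomial.algebraMap_eq]
  refine Finset.prod_congr rfl fun i _ => ?_
  congr 1
  simp only [Matrix.mul_apply, map_sum, Finset.sum_mul, Finset.mul_sum, map_mul]
  rw [Finset.sum_comm]
  refine Finset.sum_congr rfl fun j _ => Finset.sum_congr rfl fun l _ => by ring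

theorem coeff_creationPoly_mul (V W : Matrix ι ι ℂ) (n m : ι → ℕ) :
    MvPolynomial.coeff (Finsupp.equivFunOnFinite.symm n) (creationPoly (V * W) m) =
      ∑ k ∈ sector ι (∑ i, m i),
        MvPolynomial.coeff (Finsupp.equivFunOnFinite.symm n) (creationPoly V k) *
        MvPolynomial.coeff (Finsupp.equivFunOnFinite.symm k) (creationPoly W m) := by
  rw [creationPoly_mul, MvPolynomial.aeval_def, MvPolynomial.eval₂_eq', MvPolynomial.coeff_sum]
  have hsub : (creationPoly W m).support ⊆
      (sector ι (∑ i, m i)).map Finsupp.equivFunOnFinite.symm.toEmbedding := by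
    intro d hd
    rw [Finset.mem_map_equiv]
    have := creationPoly_isHomogeneous W m (MvPolynomial.mem_support_iff.mp hd)
    rw [mem_sector, ← this, Finsupp.weight_apply, Finsupp.sum_fintype _ _ (by simp)]
    simp
  rw [Finset.sum_subset hsub, Finset.sum_map]
  · refine Finset.sum_congr rfl fun k _ => ?_
    rw [MvPolynomial.algebraMap_eq, MvPolynomial.coeff_C_mul, mul_comm]
    rfl
  · intro d _ hd
    rw [MvPolynomial.notMem_support_iff.mp hd]
    simp

theorem fact_ne (n : ι → ℕ) : ((√((∏ i, (n i).factorial : ℕ) : ℝ) : ℝ) : ℂ) ≠ 0 := by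
  have : (0 : ℝ) < ((∏ i, (n i).factorial : ℕ) : ℝ) := by
    exact_mod_cast Finset.prod_pos fun i _ => Nat.factorial_pos _
  exact_mod_cast (Real.sqrt_pos.mpr this).ne'

theorem amplitude_mul (V W : Matrix ι ι ℂ) (n m : ι → ℕ) :
    amplitude (V * W) n m =
      ∑ k ∈ sector ι (∑ i, m i), amplitude V n k * amplitude W k m := by
  simp only [amplitude, coeff_creationPoly_mul, Finset.mul_sum, Complex.ofReal_div]
  refine Finset.sum_congr rfl fun k _ => ?_
  have := fact_ne k
  have := fact_ne m
  field_simp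

theorem amplitude_one (n m : ι → ℕ) : amplitude (1 : Matrix ι ι ℂ) n m = if n = m then 1 else 0 := by
  have h : creationPoly (1 : Matrix ι ι ℂ) m =
      MvPolynomial.monomial (Finsupp.equivFunOnFinite.symm m) 1 := by
    rw [MvPolynomial.monomial_eq, Finsupp.prod_fintype _ _ (by simp)]
    simp only [creationPoly, Matrix.one_apply]
    simp only [apply_ite MvPolynomial.C, map_one, map_zero, ite_mul, one_mul, zero_mul]
    simp
  rw [amplitude, h, MvPolynomial.coeff_monomial]
  have hm := fact_ne m
  by_cases hnm : n = m
  · subst hnm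
    simp only [↓reduceIte, mul_one, Complex.ofReal_div]
    exact div_self hm
  · have : ¬ m = n := fun h => hnm h.symm
    simp [hnm, this]

theorem coeff_rename_mul (a b : ι →₀ ℕ) (p q : MvPolynomial ι ℂ) :
    MvPolynomial.coeff (Finsupp.mapDomain Sum.inl a + Finsupp.mapDomain Sum.inr b)
      (MvPolynomial.rename (Sum.inl : ι → ι ⊕ ι) p * MvPolynomial.rename Sum.inr q) =
      MvPolynomial.coeff a p * MvPolynomial.coeff b q := by
  induction p using MvPolynomial.induction_on' with
  | add p₁ p₂ h₁ h₂ => simp only [map_add, add_mul, MvPolynomial.coeff_add, h₁, h₂]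
  | monomial u c =>
    induction q using MvPolynomial.induction_on' with
    | add p₁ p₂ h₁ h₂ => simp only [map_add, mul_add, MvPolynomial.coeff_add, h₁, h₂]
    | monomial v d =>
      rw [MvPolynomial.rename_monomial, MvPolynomial.rename_monomial,
        MvPolynomial.monomial_mul, MvPolynomial.coeff_monomial, MvPolynomial.coeff_monomial,
        MvPolynomial.coeff_monomial]
      have key : (Finsupp.mapDomain (Sum.inl : ι → ι ⊕ ι) u + Finsupp.mapDomain Sum.inr v =
          Finsupp.mapDomain Sum.inl a + Finsupp.mapDomain Sum.inr b) ↔ u = a ∧ v = b := by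
        constructor
        · intro h
          constructor
          · ext i
            have := DFunLike.congr_fun h (Sum.inl i)
            simpa [Finsupp.mapDomain_apply Sum.inl_injective,
              Finsupp.mapDomain_of_notMem_range] using this
          · ext i
            have := DFunLike.congr_fun h (Sum.inr i)
            simpa [Finsupp.mapDomain_apply Sum.inr_injective,
              Finsupp.mapDomain_of_notMem_range] using this
        · rintro ⟨rfl, rfl⟩; rfl
      rw [if_congr key rfl rfl]
      by_cases h₁ : u = a <;> by_cases h₂ : v = b <;> simp [h₁, h₂]

theorem coeff_bilinear_pow (V : Matrix ι ι ℂ) (n m : ι → ℕ) :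
    MvPolynomial.coeff
      (Finsupp.mapDomain Sum.inl (Finsupp.equivFunOnFinite.symm m) +
        Finsupp.mapDomain Sum.inr (Finsupp.equivFunOnFinite.symm n))
      ((∑ i, MvPolynomial.X (Sum.inl i) *
          ∑ j, MvPolynomial.C (V j i) * MvPolynomial.X (Sum.inr j) :
            MvPolynomial (ι ⊕ ι) ℂ) ^ (∑ i, m i)) =
      (Nat.multinomial Finset.univ m : ℂ) *
        MvPolynomial.coeff (Finsupp.equivFunOnFinite.symm n) (creationPoly V m) := by
  rw [Finset.sum_pow_eq_sum_piAntidiag, MvPolynomial.coeff_sum]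
  have hterm : ∀ k : ι → ℕ, (∏ i, (MvPolynomial.X (Sum.inl i) *
          ∑ j, MvPolynomial.C (V j i) * MvPolynomial.X (Sum.inr j) :
            MvPolynomial (ι ⊕ ι) ℂ) ^ k i) =
      MvPolynomial.rename (Sum.inl : ι → ι ⊕ ι)
        (MvPolynomial.monomial (Finsupp.equivFunOnFinite.symm k) 1) *
      MvPolynomial.rename Sum.inr (creationPoly V k) := by
    intro k
    rw [MvPolynomial.monomial_eq, Finsupp.prod_fintype _ _ (by simp)]
    simp [creationPoly, mul_pow, Finset.prod_mul_distrib]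
  rw [Finset.sum_eq_single m]
  · rw [hterm, ← MvPolynomial.C_eq_coe_nat, MvPolynomial.coeff_C_mul, coeff_rename_mul,
      MvPolynomial.coeff_monomial]
    simp
  · intro k _ hk
    rw [hterm, ← MvPolynomial.C_eq_coe_nat, MvPolynomial.coeff_C_mul, coeff_rename_mul,
      MvPolynomial.coeff_monomial]
    simp [hk]
  · intro h
    exact absurd (mem_sector.mpr rfl) h

theorem coeff_transpose (V : Matrix ι ι ℂ) (n m : ι → ℕ) (hnm : ∑ i, n i = ∑ i, m i) :
    (Nat.multinomial Finset.univ m : ℂ) *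
        MvPolynomial.coeff (Finsupp.equivFunOnFinite.symm n) (creationPoly V m) =
    (Nat.multinomial Finset.univ n : ℂ) *
        MvPolynomial.coeff (Finsupp.equivFunOnFinite.symm m) (creationPoly V.transpose n) := by
  rw [← coeff_bilinear_pow, ← coeff_bilinear_pow]
  have hinj : Function.Injective (Sum.swap : ι ⊕ ι → ι ⊕ ι) := Sum.swap_leftInverse.injective
  rw [← MvPolynomial.coeff_rename_mapDomain _ hinj, hnm, map_pow]
  congr 1
  · rw [Finsupp.mapDomain_add, ← Finsupp.mapDomain_comp, ← Finsupp.mapDomain_comp, add_comm]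
    rfl
  · congr 1
    simp only [map_sum, map_mul, MvPolynomial.rename_X, MvPolynomial.rename_C, Finset.mul_sum,
      Sum.swap_inl, Sum.swap_inr, Matrix.transpose_apply]
    rw [Finset.sum_comm]
    refine Finset.sum_congr rfl fun i _ => Finset.sum_congr rfl fun j _ => by ring

theorem star_coeff (V : Matrix ι ι ℂ) (n m : ι → ℕ) :
    star (MvPolynomial.coeff (Finsupp.equivFunOnFinite.symm n) (creationPoly V m)) =
      MvPolynomial.coeff (Finsupp.equivFunOnFinite.symm n) (creationPoly (V.map star) m) := by
  have : creationPoly (V.map star) m = MvPolynomial.map (starRingEnd ℂ) (creationPoly V m) := by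
    simp [creationPoly]
  rw [this, MvPolynomial.coeff_map]
  rfl

theorem star_amplitude (V : Matrix ι ι ℂ) (n m : ι → ℕ) (hnm : ∑ i, n i = ∑ i, m i) :
    star (amplitude V n m) = amplitude V.conjTranspose m n := by
  have h := coeff_transpose (V.map star) n m hnm
  have hm := Nat.multinomial_spec Finset.univ m
  have hn := Nat.multinomial_spec Finset.univ n
  rw [hnm, ← hm] at hn
  rw [amplitude, amplitude, star_mul', star_coeff]
  have e : V.conjTranspose = (V.map star).transpose := rfl
  rw [e]
  set c := MvPolynomial.coeff (Finsupp.equivFunOnFinite.symm n) (creationPoly (V.map star) m)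
  set d := MvPolynomial.coeff (Finsupp.equivFunOnFinite.symm m)
    (creationPoly (V.map star).transpose n)
  set a := ∏ i, (n i).factorial
  set b := ∏ i, (m i).factorial
  have ha : ((√(a : ℝ) : ℝ) : ℂ) ≠ 0 := fact_ne n
  have hb : ((√(b : ℝ) : ℝ) : ℂ) ≠ 0 := fact_ne m
  have ha2 : ((√(a : ℝ) : ℝ) : ℂ) * ((√(a : ℝ) : ℝ) : ℂ) = (a : ℂ) := by
    rw [← Complex.ofReal_mul, Real.mul_self_sqrt (Nat.cast_nonneg _)]; simp
  have hb2 : ((√(b : ℝ) : ℝ) : ℂ) * ((√(b : ℝ) : ℝ) : ℂ) = (b : ℂ) := by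
    rw [← Complex.ofReal_mul, Real.mul_self_sqrt (Nat.cast_nonneg _)]; simp
  have hn' : (a : ℂ) * (Nat.multinomial Finset.univ n : ℂ) = b * (Nat.multinomial Finset.univ m : ℂ) := by
    exact_mod_cast hn
  have hmz : (Nat.multinomial Finset.univ m : ℂ) ≠ 0 := by
    intro h0
    have h0' : Nat.multinomial Finset.univ m = 0 := by exact_mod_cast h0
    rw [h0', mul_zero] at hm
    exact (Nat.factorial_pos _).ne hm
  have hcd : (a : ℂ) * c = b * d := by
    apply mul_left_cancel₀ hmz
    calc (Nat.multinomial Finset.univ m : ℂ) * (a * c) = a * ((Nat.multinomial Finset.univ m : ℂ) * c) := by ring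
      _ = (a * (Nat.multinomial Finset.univ n : ℂ)) * d := by rw [h]; ring
      _ = (Nat.multinomial Finset.univ m : ℂ) * (b * d) := by rw [hn']; ring
  rw [Complex.star_def, Complex.conj_ofReal, Complex.ofReal_div, Complex.ofReal_div]
  rw [← ha2, ← hb2] at hcd
  field_simp
  linear_combination hcd

end amplitudes

section operators
variable {ι : Type*} [Fintype ι] [DecidableEq ι]

theorem fockAction_mul (V W : Matrix ι ι ℂ) (ψ : (ι → ℕ) → ℂ) :
    fockAction V (fockAction W ψ) = fockAction (V * W) ψ := by
  funext n
  simp only [fockAction, Finset.mul_sum]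
  have h : ∀ k ∈ sector ι (∑ i, n i), ∑ m ∈ sector ι (∑ i, k i),
      amplitude V n k * (amplitude W k m * ψ m) = ∑ m ∈ sector ι (∑ i, n i),
      amplitude V n k * (amplitude W k m * ψ m) := by
    intro k hk
    rw [mem_sector.mp hk]
  rw [Finset.sum_congr rfl h, Finset.sum_comm]
  refine Finset.sum_congr rfl fun m hm => ?_
  rw [amplitude_mul, Finset.sum_mul, mem_sector.mp hm]
  exact Finset.sum_congr rfl fun k _ => by ring

theorem fockAction_one (ψ : (ι → ℕ) → ℂ) : fockAction (1 : Matrix ι ι ℂ) ψ = ψ := by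
  funext n
  simp [fockAction, amplitude_one]

theorem sum_sector_norm_sq (V : Matrix.unitaryGroup ι ℂ) (ψ : (ι → ℕ) → ℂ) (N : ℕ) :
    ∑ n ∈ sector ι N, ‖fockAction V.1 ψ n‖ ^ 2 = ∑ n ∈ sector ι N, ‖ψ n‖ ^ 2 := by
  have hV : V.1.conjTranspose * V.1 = 1 := Matrix.UnitaryGroup.star_mul_self V
  have hsq : ∀ z : ℂ, ((‖z‖ ^ 2 : ℝ) : ℂ) = star z * z := fun z => by
    rw [Complex.star_def, Complex.conj_mul']; push_cast; rfl
  have key : ∑ n ∈ sector ι N, star (fockAction V.1 ψ n) * fockAction V.1 ψ n =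
      ∑ n ∈ sector ι N, star (ψ n) * ψ n := by
    calc ∑ n ∈ sector ι N, star (fockAction V.1 ψ n) * fockAction V.1 ψ n
        = ∑ n ∈ sector ι N, ∑ m ∈ sector ι N,
            star (ψ m) * (amplitude V.1.conjTranspose m n * fockAction V.1 ψ n) := by
          refine Finset.sum_congr rfl fun n hn => ?_
          have hn' := mem_sector.mp hn
          have e : star (fockAction V.1 ψ n) =
              ∑ m ∈ sector ι N, star (amplitude V.1 n m * ψ m) := by
            rw [fockAction, hn', star_sum]
          rw [e, Finset.sum_mul]
          refine Finset.sum_congr rfl fun m hm => ?_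
          rw [star_mul', star_amplitude _ _ _ (hn'.trans (mem_sector.mp hm).symm)]
          ring
      _ = ∑ m ∈ sector ι N, star (ψ m) * fockAction V.1.conjTranspose (fockAction V.1 ψ) m := by
          rw [Finset.sum_comm]
          refine Finset.sum_congr rfl fun m hm => ?_
          conv_rhs => rw [fockAction, mem_sector.mp hm, Finset.mul_sum]
      _ = ∑ n ∈ sector ι N, star (ψ n) * ψ n := by
          rw [fockAction_mul, hV, fockAction_one]
  apply Complex.ofReal_injective
  simpa only [Complex.ofReal_sum, hsq] using key

theorem sum_le_of_sector_sum {f g : (ι → ℕ) → ℝ} (hf : Summable f) (hf0 : ∀ n, 0 ≤ f n)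
    (hg0 : ∀ n, 0 ≤ g n) (h : ∀ N, ∑ n ∈ sector ι N, g n = ∑ n ∈ sector ι N, f n)
    (s : Finset (ι → ℕ)) : ∑ n ∈ s, g n ≤ ∑' n, f n := by
  have hdisj : ((s.image fun n => ∑ i, n i : Finset ℕ) : Set ℕ).PairwiseDisjoint (sector ι) := by
    intro N _ M _ hNM
    refine Finset.disjoint_left.mpr fun n h₁ h₂ => hNM ?_
    rw [← mem_sector.mp h₁, ← mem_sector.mp h₂]
  calc ∑ n ∈ s, g n ≤ ∑ n ∈ (s.image fun n => ∑ i, n i).biUnion (sector ι), g n := by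
        refine Finset.sum_le_sum_of_subset_of_nonneg (fun n hn => ?_) fun n _ _ => hg0 n
        exact Finset.mem_biUnion.mpr
          ⟨_, Finset.mem_image_of_mem _ hn, mem_sector.mpr rfl⟩
    _ = ∑ n ∈ (s.image fun n => ∑ i, n i).biUnion (sector ι), f n := by
        rw [Finset.sum_biUnion hdisj, Finset.sum_biUnion hdisj]
        exact Finset.sum_congr rfl fun N _ => h N
    _ ≤ ∑' n, f n := hf.sum_le_tsum _ fun n _ => hf0 n

theorem two_toReal_pos : 0 < (2 : ENNReal).toReal := by norm_num

theorem summable_norm_sq {κ : Type*} (ψ : lp (fun _ : κ => ℂ) 2) :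
    Summable fun n => ‖ψ n‖ ^ 2 := by
  simpa using (lp.memℓp ψ).summable two_toReal_pos

theorem norm_sq_eq_tsum {κ : Type*} (ψ : lp (fun _ : κ => ℂ) 2) :
    ‖ψ‖ ^ 2 = ∑' n, ‖ψ n‖ ^ 2 := by
  simpa using lp.norm_rpow_eq_tsum two_toReal_pos ψ

theorem memℓp_two {κ : Type*} {f : κ → ℂ} (h : Summable fun n => ‖f n‖ ^ 2) :
    Memℓp (E := fun _ => ℂ) f 2 :=
  memℓp_gen (by simpa using h)

theorem memℓp_fockAction (V : Matrix.unitaryGroup ι ℂ) (ψ : Fock ι) :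
    Memℓp (E := fun _ => ℂ) (fockAction V.1 ψ) 2 :=
  memℓp_two (summable_of_sum_le (fun n => by positivity)
    (sum_le_of_sector_sum (summable_norm_sq ψ) (fun n => by positivity) (fun n => by positivity)
      (sum_sector_norm_sq V ψ)))

/-- The unitary operator on Fock space implementing the linear-optics transformation
`a†_i ↦ ∑ j, V j i a†_j` and fixing the vacuum. -/
noncomputable def secondQuantization (V : Matrix.unitaryGroup ι ℂ) : Fock ι ≃ₗᵢ[ℂ] Fock ι where
  toFun ψ := ⟨fockAction V.1 ψ, memℓp_fockAction V ψ⟩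
  invFun ψ := ⟨fockAction (V⁻¹).1 ψ, memℓp_fockAction V⁻¹ ψ⟩
  map_add' ψ φ := by
    ext n
    change fockAction V.1 (⇑ψ + ⇑φ) n = fockAction V.1 ψ n + fockAction V.1 φ n
    simp [fockAction, mul_add, Finset.sum_add_distrib]
  map_smul' c ψ := by
    ext n
    simp only [fockAction, lp.coeFn_smul, Pi.smul_apply, smul_eq_mul, RingHom.id_apply,
      Finset.mul_sum]
    exact Finset.sum_congr rfl fun m _ => by ring
  left_inv ψ := by
    ext n
    change fockAction (V⁻¹).1 (fockAction V.1 ψ) n = ψ n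
    have : (V⁻¹).1 * V.1 = 1 := congrArg Subtype.val (inv_mul_cancel V)
    rw [fockAction_mul, this, fockAction_one]
  right_inv ψ := by
    ext n
    change fockAction V.1 (fockAction (V⁻¹).1 ψ) n = ψ n
    have : V.1 * (V⁻¹).1 = 1 := congrArg Subtype.val (mul_inv_cancel V)
    rw [fockAction_mul, this, fockAction_one]
  norm_map' ψ := by
    change ‖(⟨fockAction V.1 ψ, memℓp_fockAction V ψ⟩ : Fock ι)‖ = ‖ψ‖
    set φ : Fock ι := ⟨fockAction V.1 ψ, memℓp_fockAction V ψ⟩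
    have h : ∀ N, ∑ n ∈ sector ι N, ‖φ n‖ ^ 2 = ∑ n ∈ sector ι N, ‖ψ n‖ ^ 2 :=
      sum_sector_norm_sq V ψ
    have h₁ : ‖φ‖ ^ 2 = ‖ψ‖ ^ 2 := by
      rw [norm_sq_eq_tsum, norm_sq_eq_tsum]
      refine le_antisymm ?_ ?_
      · exact (summable_norm_sq φ).tsum_le_of_sum_le (sum_le_of_sector_sum (summable_norm_sq ψ)
          (fun n => by positivity) (fun n => by positivity) h)
      · exact (summable_norm_sq ψ).tsum_le_of_sum_le (sum_le_of_sector_sum (summable_norm_sq φ)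
          (fun n => by positivity) (fun n => by positivity) fun N => (h N).symm)
    exact (pow_left_inj₀ (norm_nonneg _) (norm_nonneg _) two_ne_zero).mp h₁

end operators

section partialTrace
variable {S T : Type*}

theorem joint_injective (t : T → ℕ) :
    Function.Injective fun n : S → ℕ => (Sum.elim n t : S ⊕ T → ℕ) := fun a b h => by
  funext i
  exact congrFun h (Sum.inl i)

/-- `1 ⊗ ⟨t|`: the contraction of the modes `T` with the Fock basis state `|t⟩`. -/
noncomputable def braRight (t : T → ℕ) : Fock (S ⊕ T) →L[ℂ] Fock S :=
  LinearMap.mkContinuous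
    { toFun := fun Ψ => ⟨fun n => Ψ (Sum.elim n t),
        memℓp_two ((summable_norm_sq Ψ).comp_injective (joint_injective t))⟩
      map_add' := fun Ψ Φ => by ext n; rfl
      map_smul' := fun c Ψ => by ext n; rfl } 1 (fun Ψ => by
    rw [one_mul]
    refine (pow_le_pow_iff_left₀ (norm_nonneg _) (norm_nonneg _) two_ne_zero).mp ?_
    rw [norm_sq_eq_tsum, norm_sq_eq_tsum]
    exact ((summable_norm_sq Ψ).comp_injective (joint_injective t)).tsum_le_tsum_of_inj
      _ (joint_injective t) (fun _ _ => by positivity) (fun _ => le_rfl) (summable_norm_sq Ψ))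

/-- `1 ⊗ |t⟩`: adjoining the modes `T` in the Fock basis state `|t⟩`. -/
noncomputable def ketRight (t : T → ℕ) : Fock S →L[ℂ] Fock (S ⊕ T) :=
  ContinuousLinearMap.adjoint (braRight t)

/-- The partial trace over the modes `T`, `tr_T ρ = ∑ t, (1 ⊗ ⟨t|) ρ (1 ⊗ |t⟩)`, as a bounded operator
on the Fock space of the remaining modes. The sum converges in operator norm for every `ρ = |Ψ⟩⟨Ψ|`;
see `summable_partialTraceRight`. -/
noncomputable def partialTraceRight (ρ : Fock (S ⊕ T) →L[ℂ] Fock (S ⊕ T)) :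
    Fock S →L[ℂ] Fock S :=
  ∑' t : T → ℕ, braRight t ∘L ρ ∘L ketRight t

/-- The operator `P̂(Ψ) = |Ψ⟩⟨Ψ|`. -/
noncomputable def pureState {H : Type*} [NormedAddCommGroup H] [InnerProductSpace ℂ H] (Ψ : H) :
    H →L[ℂ] H :=
  InnerProductSpace.rankOne ℂ Ψ Ψ

theorem braRight_apply (t : T → ℕ) (Ψ : Fock (S ⊕ T)) (n : S → ℕ) :
    braRight t Ψ n = Ψ (Sum.elim n t) := rfl

theorem summable_partialTraceRight (Ψ : Fock (S ⊕ T)) :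
    Summable fun t : T → ℕ => braRight t ∘L pureState Ψ ∘L (ketRight t : Fock S →L[ℂ] _) := by
  have heq : ∀ t : T → ℕ, braRight t ∘L pureState Ψ ∘L (ketRight t : Fock S →L[ℂ] _) =
      pureState (braRight t Ψ) := by
    intro t
    ext1 φ
    simp [pureState, ketRight, ContinuousLinearMap.adjoint_inner_right]
  simp only [heq]
  refine Summable.of_norm ?_
  have hn : ∀ t : T → ℕ, ‖pureState (braRight t Ψ : Fock S)‖ =
      ∑' n : S → ℕ, ‖Ψ (Sum.elim n t)‖ ^ 2 := by
    intro t
    rw [pureState, InnerProductSpace.norm_rankOne, ← sq, norm_sq_eq_tsum]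
    rfl
  simp only [hn]
  have hs := (Equiv.sumArrowEquivProdArrow S T ℕ).symm.summable_iff.mpr (summable_norm_sq Ψ)
  have hs' := (Equiv.prodComm (T → ℕ) (S → ℕ)).summable_iff.mpr hs
  exact hs'.prod

end partialTrace

section optics
variable {S : Type*} [Fintype S] [DecidableEq S]
variable {Slot : Type*} [Fintype Slot] [DecidableEq Slot]

/-- The mode transformation of a beam splitter with transmittance `η`, with ports `0, 1`:
`a†_0 ↦ √(1 - η) a†_0' + √η a†_1'` and `a†_1 ↦ √η a†_0' - √(1 - η) a†_1'`
(the columns are the images). -/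
noncomputable def bsMatrix (η : unitInterval) : Matrix (Fin 2) (Fin 2) ℂ :=
  !![((√(1 - (η : ℝ)) : ℝ) : ℂ), ((√(η : ℝ) : ℝ) : ℂ);
     ((√(η : ℝ) : ℝ) : ℂ), -((√(1 - (η : ℝ)) : ℝ) : ℂ)]

theorem sqrt_mul_self_add (η : unitInterval) :
    ((√(η : ℝ) : ℝ) : ℂ) * ((√(η : ℝ) : ℝ) : ℂ) +
      ((√(1 - (η : ℝ)) : ℝ) : ℂ) * ((√(1 - (η : ℝ)) : ℝ) : ℂ) = 1 := by
  rw [← Complex.ofReal_mul, ← Complex.ofReal_mul, ← Complex.ofReal_add,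
    Real.mul_self_sqrt η.2.1, Real.mul_self_sqrt (sub_nonneg.mpr η.2.2)]
  simp

theorem bsMatrix_mul_conjTranspose (η : unitInterval) :
    bsMatrix η * (bsMatrix η).conjTranspose = 1 := by
  have h := sqrt_mul_self_add η
  ext i j
  fin_cases i <;> fin_cases j <;>
    simp [bsMatrix, Matrix.mul_apply, Fin.sum_univ_two] <;>
    first | linear_combination h | ring

/-- The same beam splitter of transmittance `η` acting in every time slot on the two ports of that
slot. -/
noncomputable def bsMode (Slot : Type*) [Fintype Slot] [DecidableEq Slot] (η : unitInterval) :
    Matrix.unitaryGroup (Fin 2 × Slot) ℂ :=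
  ⟨Matrix.blockDiagonal fun _ : Slot => bsMatrix η, by
    rw [Matrix.mem_unitaryGroup_iff, Matrix.star_eq_conjTranspose,
      Matrix.blockDiagonal_conjTranspose, ← Matrix.blockDiagonal_mul]
    simp only [bsMatrix_mul_conjTranspose]
    exact Matrix.blockDiagonal_one⟩

/-- The delay line: in the arm `0`, the pulse of the time slot `k` is moved to the slot `σ k`; the arm
`1` is unchanged. -/
def delayPerm (σ : Equiv.Perm Slot) : Equiv.Perm (Fin 2 × Slot) :=
  Equiv.prodCongrRight fun p : Fin 2 => if p = 0 then σ else Equiv.refl Slot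

/-- The mode transformation `a†_i ↦ a†_(delayPerm σ i)` of the delay line. -/
noncomputable def delayMode (σ : Equiv.Perm Slot) : Matrix.unitaryGroup (Fin 2 × Slot) ℂ :=
  ⟨(delayPerm σ)⁻¹.permMatrix ℂ, by
    rw [Matrix.mem_unitaryGroup_iff, Matrix.star_eq_conjTranspose, Matrix.conjTranspose_permMatrix,
      ← Matrix.permMatrix_mul]
    simp⟩

/-- A mode transformation of the signal modes `inl s`, leaving the loss modes `inr s` alone. -/
noncomputable def onSignal (V : Matrix.unitaryGroup S ℂ) : Matrix.unitaryGroup (S ⊕ S) ℂ :=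
  ⟨Matrix.fromBlocks V.1 0 0 1, by
    have h : V.1 * V.1.conjTranspose = 1 := Matrix.mem_unitaryGroup_iff.mp V.2
    rw [Matrix.mem_unitaryGroup_iff, Matrix.star_eq_conjTranspose,
      Matrix.fromBlocks_conjTranspose, Matrix.fromBlocks_multiply]
    simp [h]⟩

/-- The loss beam splitters: each signal mode `inl s` meets its own loss mode `inr s` at a beam splitter
of transmittance `η`, `a†_(inl s) ↦ √η a†_(inl s) + √(1 - η) a†_(inr s)` and
`a†_(inr s) ↦ √η a†_(inr s) - √(1 - η) a†_(inl s)`. -/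
noncomputable def lossMode (S : Type*) [Fintype S] [DecidableEq S] (η : unitInterval) :
    Matrix.unitaryGroup (S ⊕ S) ℂ :=
  ⟨Matrix.fromBlocks (((√(η : ℝ) : ℝ) : ℂ) • 1) (-((√(1 - (η : ℝ)) : ℝ) : ℂ) • 1)
      (((√(1 - (η : ℝ)) : ℝ) : ℂ) • 1) (((√(η : ℝ) : ℝ) : ℂ) • 1), by
    have h := sqrt_mul_self_add η
    rw [Matrix.mem_unitaryGroup_iff, Matrix.star_eq_conjTranspose,
      Matrix.fromBlocks_conjTranspose, Matrix.fromBlocks_multiply, ← Matrix.fromBlocks_one]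
    simp only [Matrix.conjTranspose_smul, Matrix.conjTranspose_one, Matrix.smul_mul, Matrix.one_mul,
      smul_smul, ← add_smul, Complex.star_def, Complex.conj_ofReal, map_neg]
    congr 1
    · rw [show ∀ a b : ℂ, a * a + -b * -b = a * a + b * b from fun a b => by ring, h, one_smul]
    · rw [show ∀ a b : ℂ, a * b + -b * a = 0 from fun a b => by ring, zero_smul]
    · rw [show ∀ a b : ℂ, b * a + a * -b = 0 from fun a b => by ring, zero_smul]
    · rw [show ∀ a b : ℂ, b * b + a * a = a * a + b * b from fun a b => by ring, h, one_smul]⟩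

/-- `Û_η`: the unitary of the `η`-beam splitter on the Fock space of all signal and loss modes. -/
noncomputable def bsU (η : unitInterval) :
    Fock ((Fin 2 × Slot) ⊕ (Fin 2 × Slot)) ≃ₗᵢ[ℂ] Fock ((Fin 2 × Slot) ⊕ (Fin 2 × Slot)) :=
  secondQuantization (onSignal (bsMode Slot η))

/-- The unitary of the delay line in the arm `0` of the interferometer. -/
noncomputable def delayU (σ : Equiv.Perm Slot) :
    Fock ((Fin 2 × Slot) ⊕ (Fin 2 × Slot)) ≃ₗᵢ[ℂ] Fock ((Fin 2 × Slot) ⊕ (Fin 2 × Slot)) :=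
  secondQuantization (onSignal (delayMode σ))

/-- `Û_η_det`: the unitary of the loss beam splitters modelling the detection efficiency. -/
noncomputable def lossU (η : unitInterval) : Fock (S ⊕ S) ≃ₗᵢ[ℂ] Fock (S ⊕ S) :=
  secondQuantization (lossMode S η)

/-- The Mach-Zehnder interferometer: first beam splitter, delay line, second beam splitter. Port `0` of
the first beam splitter carries the received pulses, its output ports `0, 1` are the upper and the lower
arm, and the output ports `0, 1` of the second beam splitter lead to the two detectors. -/
noncomputable def machZehnderU (η₁ η₂ : unitInterval) (σ : Equiv.Perm Slot)
    (Ψ : Fock ((Fin 2 × Slot) ⊕ (Fin 2 × Slot))) : Fock ((Fin 2 × Slot) ⊕ (Fin 2 × Slot)) :=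
  bsU η₂ (delayU σ (bsU η₁ Ψ))

/-- `|φ⟩|vac⟩`: the signal modes in the state `φ` and the loss modes in the vacuum. -/
noncomputable def withVacuum (φ : Fock S) : Fock (S ⊕ S) :=
  ketRight (0 : S → ℕ) φ

/-- `tr_T |Ψ⟩⟨Ψ|`: the state of the signal modes after the loss modes are traced out. -/
noncomputable def signalState (Ψ : Fock (S ⊕ S)) : Fock S →L[ℂ] Fock S :=
  partialTraceRight (pureState Ψ)

end optics

end BosonicOptics

open BosonicOptics

/-!
The loss beam splitters have the same efficiency for every signal mode, so their mode matrix is made of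
scalar blocks and commutes with `W ⊕ W` for every unitary `W`: applying `W` to the signal modes and, in
parallel, to the loss modes (`lossMode_comm`). Acting on the loss modes alone changes nothing at either
end of the calculation. Before the loss it acts on the vacuum, which it fixes
(`secondQuantization_onLoss_withVacuum`); after the loss it is a unitary of the modes that are traced out
(`signalState_onLoss`). Hence

`L W |φ⟩|vac⟩ = L (W ⊕ W) |φ⟩|vac⟩ = (W ⊕ W) L |φ⟩|vac⟩`,

and the last vector has the same signal state as `W L |φ⟩|vac⟩`. This holds for every linear-optics network
`W` on the signal modes, in particular for one beam splitter and for the Mach-Zehnder interferometer.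

Both facts about the loss modes come from `braRight_onLoss`: contracting the transformed loss modes with a
Fock state `⟨t|` gives a finite combination of contractions of the original vector. The invariance of the
partial trace then reduces, through quadratic forms, to the isometry of `secondQuantization` on the loss
modes.
-/

namespace BosonicOptics

/-! ### Composition of linear-optics transformations -/

section composition
variable {ι : Type*} [Fintype ι] [DecidableEq ι]

theorem secondQuantization_apply (V : Matrix.unitaryGroup ι ℂ) (ψ : Fock ι) (n : ι → ℕ) :
    secondQuantization V ψ n = fockAction V.1 ψ n := rfl

theorem secondQuantization_mul (V W : Matrix.unitaryGroup ι ℂ) (ψ : Fock ι) :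
    secondQuantization (V * W) ψ = secondQuantization V (secondQuantization W ψ) := by
  ext n
  exact (congrFun (fockAction_mul V.1 W.1 ψ) n).symm

theorem secondQuantization_one (ψ : Fock ι) :
    secondQuantization (1 : Matrix.unitaryGroup ι ℂ) ψ = ψ := by
  ext n
  exact congrFun (fockAction_one (ψ : (ι → ℕ) → ℂ)) n

end composition

theorem amplitude_zero_zero {ι : Type*} [Fintype ι] (V : Matrix ι ι ℂ) : amplitude V 0 0 = 1 := by
  have h : Finsupp.equivFunOnFinite.symm (0 : ι → ℕ) = 0 := by ext; rfl
  simp [amplitude, creationPoly, h]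

section loss
variable {S : Type*} [Fintype S] [DecidableEq S]

/-! ### Transformations of the loss modes -/

/-- A mode transformation of the loss modes `inr s`, leaving the signal modes `inl s` alone. -/
noncomputable def onLoss (V : Matrix.unitaryGroup S ℂ) : Matrix.unitaryGroup (S ⊕ S) ℂ :=
  ⟨Matrix.fromBlocks 1 0 0 V.1, by
    have h : V.1 * V.1.conjTranspose = 1 := Matrix.mem_unitaryGroup_iff.mp V.2
    rw [Matrix.mem_unitaryGroup_iff, Matrix.star_eq_conjTranspose,
      Matrix.fromBlocks_conjTranspose, Matrix.fromBlocks_multiply]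
    simp [h]⟩

theorem onSignal_mul (V W : Matrix.unitaryGroup S ℂ) :
    onSignal (V * W) = onSignal V * onSignal W := by
  apply Subtype.ext
  simp [onSignal, Matrix.fromBlocks_multiply]

theorem onLoss_mul (V W : Matrix.unitaryGroup S ℂ) : onLoss (V * W) = onLoss V * onLoss W := by
  apply Subtype.ext
  simp [onLoss, Matrix.fromBlocks_multiply]

theorem onLoss_one : onLoss (1 : Matrix.unitaryGroup S ℂ) = 1 := by
  apply Subtype.ext
  simp [onLoss]

/-- Losses of a common efficiency commute with the same transformation `W` applied to the signal modes and
to the loss modes: the blocks of `lossMode` are scalar. -/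
theorem lossMode_comm (η : unitInterval) (W : Matrix.unitaryGroup S ℂ) :
    lossMode S η * (onLoss W * onSignal W) = onLoss W * onSignal W * lossMode S η := by
  apply Subtype.ext
  simp [lossMode, onLoss, onSignal, Matrix.fromBlocks_multiply]

theorem creationPoly_onLoss (V : Matrix.unitaryGroup S ℂ) (m u : S → ℕ) :
    creationPoly (onLoss V).1 (Sum.elim m u) =
      MvPolynomial.rename (Sum.inl : S → S ⊕ S)
        (MvPolynomial.monomial (Finsupp.equivFunOnFinite.symm m) 1) *
      MvPolynomial.rename Sum.inr (creationPoly V.1 u) := by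
  rw [MvPolynomial.monomial_eq, Finsupp.prod_fintype _ _ (by simp)]
  simp only [creationPoly, onLoss, Fintype.prod_sum_type, Fintype.sum_sum_type, Sum.elim_inl,
    Sum.elim_inr, Matrix.fromBlocks_apply₁₁, Matrix.fromBlocks_apply₁₂, Matrix.fromBlocks_apply₂₁,
    Matrix.fromBlocks_apply₂₂, Matrix.one_apply, apply_ite MvPolynomial.C, ite_mul]
  simp

/-- The matrix elements of a transformation of the loss modes factorize, with a Kronecker delta for the
signal modes. -/
theorem amplitude_onLoss (V : Matrix.unitaryGroup S ℂ) (n t m u : S → ℕ) :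
    amplitude (onLoss V).1 (Sum.elim n t) (Sum.elim m u) =
      if n = m then amplitude V.1 t u else 0 := by
  have h : Finsupp.equivFunOnFinite.symm (Sum.elim n t) =
      Finsupp.mapDomain Sum.inl (Finsupp.equivFunOnFinite.symm n) +
        Finsupp.mapDomain Sum.inr (Finsupp.equivFunOnFinite.symm t) := by
    ext i
    cases i <;> simp [Finsupp.mapDomain_apply Sum.inl_injective,
      Finsupp.mapDomain_apply Sum.inr_injective, Finsupp.mapDomain_of_notMem_range]
  rw [amplitude, creationPoly_onLoss, h, coeff_rename_mul, MvPolynomial.coeff_monomial]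
  by_cases hnm : n = m
  · subst hnm
    have hn : √((∏ i, (n i).factorial : ℕ) : ℝ) ≠ 0 := by
      exact_mod_cast fact_ne n
    simp only [↓reduceIte, one_mul, Fintype.prod_sum_type, Sum.elim_inl, Sum.elim_inr, amplitude]
    rw [Nat.cast_mul, Nat.cast_mul, Real.sqrt_mul (Nat.cast_nonneg _),
      Real.sqrt_mul (Nat.cast_nonneg _), mul_div_mul_left _ _ hn]
  · have hmn : ¬ m = n := fun h => hnm h.symm
    simp [hnm, hmn]

/-- Contracting the transformed loss modes with `⟨t|` amounts to contracting the original ones with the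
combination `⟨t| Γ(V) = ∑ u, ⟨t| Γ(V) |u⟩ ⟨u|`. -/
theorem braRight_onLoss (V : Matrix.unitaryGroup S ℂ) (t : S → ℕ) (Ψ : Fock (S ⊕ S)) :
    braRight t (secondQuantization (onLoss V) Ψ) =
      ∑ u ∈ sector S (∑ i, t i), amplitude V.1 t u • (braRight u Ψ : Fock S) := by
  ext n
  rw [braRight_apply, secondQuantization_apply, fockAction, lp.coeFn_sum, Finset.sum_apply]
  symm
  -- Only the terms whose signal occupation numbers equal `n` survive.
  refine Finset.sum_of_injOn (fun u : S → ℕ => (Sum.elim n u : S ⊕ S → ℕ)) ?_ ?_ ?_ ?_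
  · intro u _ v _ h
    funext i
    exact congrFun h (Sum.inr i)
  · intro u hu
    have hu' : ∑ i, u i = ∑ i, t i := mem_sector.mp hu
    exact mem_sector.mpr (by simp [Fintype.sum_sum_type, hu'])
  · intro k hk hk'
    have hk₀ := mem_sector.mp hk
    simp only [Fintype.sum_sum_type, Sum.elim_inl, Sum.elim_inr] at hk₀
    have e : k = Sum.elim (k ∘ Sum.inl) (k ∘ Sum.inr) := (Sum.elim_comp_inl_inr k).symm
    rw [e, amplitude_onLoss, if_neg, zero_mul]
    intro hn
    refine hk' ⟨k ∘ Sum.inr, mem_sector.mpr ?_, ?_⟩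
    · have h₁ : ∑ i, n i = ∑ i, k (Sum.inl i) := by rw [hn]; rfl
      simp only [Function.comp_apply]
      omega
    · rw [hn]
      exact e.symm
  · intro u _
    rw [amplitude_onLoss, if_pos rfl]
    rfl

/-! ### The vacuum and the partial trace of the loss modes -/

theorem braRight_zero_onLoss (V : Matrix.unitaryGroup S ℂ) (Ψ : Fock (S ⊕ S)) :
    braRight (0 : S → ℕ) (secondQuantization (onLoss V) Ψ) = braRight (0 : S → ℕ) Ψ := by
  rw [braRight_onLoss]
  simp [sector, amplitude_zero_zero]

theorem secondQuantization_onLoss_withVacuum (V : Matrix.unitaryGroup S ℂ) (φ : Fock S) :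
    secondQuantization (onLoss V) (withVacuum φ) = withVacuum φ := by
  refine ext_inner_right ℂ fun Ψ => ?_
  have hΨ : Ψ = secondQuantization (onLoss V) (secondQuantization (onLoss V⁻¹) Ψ) := by
    rw [← secondQuantization_mul, ← onLoss_mul, mul_inv_cancel, onLoss_one, secondQuantization_one]
  conv_lhs => rw [hΨ, LinearIsometryEquiv.inner_map_map]
  simp only [withVacuum, ketRight, ContinuousLinearMap.adjoint_inner_left, braRight_zero_onLoss]

/-- A bounded operator on a complex inner product space is determined by its quadratic form. -/
theorem eq_of_inner_self_eq {E : Type*} [NormedAddCommGroup E] [InnerProductSpace ℂ E]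
    {A B : E →L[ℂ] E} (h : ∀ x, inner ℂ x (A x) = inner ℂ x (B x)) : A = B := by
  apply ContinuousLinearMap.coe_injective
  refine (ext_inner_map _ _).mp fun x => ?_
  rw [← inner_conj_symm, ← inner_conj_symm (((B : E →L[ℂ] E) : E →ₗ[ℂ] E) x)]
  exact congrArg _ (h x)

/-- The quadratic form of the signal state, summed over the Fock states of the loss modes. -/
theorem hasSum_inner_signalState {S : Type*} (Ψ : Fock (S ⊕ S)) (x : Fock S) :
    HasSum (fun t : S → ℕ => ((‖inner ℂ x (braRight t Ψ : Fock S)‖ ^ 2 : ℝ) : ℂ))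
      (inner ℂ x (signalState Ψ x)) := by
  have h := ((summable_partialTraceRight Ψ).hasSum.mapL
    (ContinuousLinearMap.apply ℂ (Fock S) x)).mapL (innerSL ℂ x)
  have e : (fun t : S → ℕ => ((‖inner ℂ x (braRight t Ψ : Fock S)‖ ^ 2 : ℝ) : ℂ)) = fun t =>
      innerSL ℂ x (ContinuousLinearMap.apply ℂ (Fock S) x
        (braRight t ∘L pureState Ψ ∘L ketRight t)) := by
    funext t
    simp only [ContinuousLinearMap.apply_apply, ContinuousLinearMap.comp_apply, innerSL_apply_apply,
      pureState, ketRight, InnerProductSpace.rankOne_apply, map_smul,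
      ContinuousLinearMap.adjoint_inner_right]
    rw [← inner_conj_symm, smul_eq_mul, Complex.mul_conj', RCLike.norm_conj]
    push_cast
    rfl
  rw [e]
  exact h

/-- A unitary of the modes that are traced out does not change the signal state. -/
theorem signalState_onLoss (V : Matrix.unitaryGroup S ℂ) (Ψ : Fock (S ⊕ S)) :
    signalState (secondQuantization (onLoss V) Ψ) = signalState Ψ := by
  refine eq_of_inner_self_eq fun x => ?_
  have h := hasSum_inner_signalState Ψ x
  have h' := hasSum_inner_signalState (secondQuantization (onLoss V) Ψ) x
  -- The overlaps `⟨x, t | Ψ⟩` form a vector `f` of the Fock space of the loss modes, on which the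
  -- transformation acts as `secondQuantization V`.
  have hs : Summable fun t : S → ℕ => ‖inner ℂ x (braRight t Ψ : Fock S)‖ ^ 2 := by
    exact_mod_cast Complex.summable_ofReal.mp h.summable
  let f : Fock S := ⟨fun t => inner ℂ x (braRight t Ψ : Fock S), memℓp_two hs⟩
  have hf : ∀ t, inner ℂ x (braRight t (secondQuantization (onLoss V) Ψ) : Fock S) =
      secondQuantization V f t := by
    intro t
    rw [braRight_onLoss, inner_sum, secondQuantization_apply, fockAction]
    exact Finset.sum_congr rfl fun u _ => inner_smul_right _ _ _
  have e : ∑' t, ‖secondQuantization V f t‖ ^ 2 = ∑' t, ‖f t‖ ^ 2 := by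
    rw [← norm_sq_eq_tsum, ← norm_sq_eq_tsum, LinearIsometryEquiv.norm_map]
  simp only [hf] at h'
  refine h'.tsum_eq.symm.trans (Eq.trans ?_ h.tsum_eq)
  rw [← Complex.ofReal_tsum, ← Complex.ofReal_tsum, e]

/-! ### Moving the losses through a linear-optics network -/

/-- Losses of a common efficiency may be moved through every linear-optics network on the signal modes. -/
theorem signalState_lossU_onSignal (η : unitInterval) (W : Matrix.unitaryGroup S ℂ) (φ : Fock S) :
    signalState (lossU η (secondQuantization (onSignal W) (withVacuum φ))) =
      signalState (secondQuantization (onSignal W) (lossU η (withVacuum φ))) := by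
  have hcomm : onSignal W * onLoss W = onLoss W * onSignal W := by
    apply Subtype.ext
    simp [onLoss, onSignal, Matrix.fromBlocks_multiply]
  have h : lossU η (secondQuantization (onSignal W) (withVacuum φ)) =
      secondQuantization (onLoss W)
        (secondQuantization (onSignal W) (lossU η (withVacuum φ))) := by
    conv_lhs => rw [← secondQuantization_onLoss_withVacuum W φ]
    simp only [lossU, ← secondQuantization_mul]
    rw [hcomm, lossMode_comm, mul_assoc]
  rw [h, signalState_onLoss]

end loss

theorem machZehnderU_eq {Slot : Type*} [Fintype Slot] [DecidableEq Slot] (η₁ η₂ : unitInterval)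
    (σ : Equiv.Perm Slot) (Ψ : Fock ((Fin 2 × Slot) ⊕ (Fin 2 × Slot))) :
    machZehnderU η₁ η₂ σ Ψ =
      secondQuantization (onSignal (bsMode Slot η₂ * (delayMode σ * bsMode Slot η₁))) Ψ := by
  simp only [machZehnderU, bsU, delayU, onSignal_mul, secondQuantization_mul]

end BosonicOptics

open BosonicOptics
theorem theorem1 {Slot : Type*} [Fintype Slot] [DecidableEq Slot] (ηdet : unitInterval) :
    (∀ (η : unitInterval) (ψ : Fock (Fin 2 × Slot)),
      signalState (bsU η (lossU ηdet (withVacuum ψ))) =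
        signalState (lossU ηdet (bsU η (withVacuum ψ)))) ∧
    (∀ (η₁ η₂ : unitInterval) (σ : Equiv.Perm Slot) (φ : Fock (Fin 2 × Slot)),
      signalState (lossU ηdet (machZehnderU η₁ η₂ σ (withVacuum φ))) =
        signalState (machZehnderU η₁ η₂ σ (lossU ηdet (withVacuum φ)))) := by
  refine ⟨fun η ψ => (signalState_lossU_onSignal ηdet _ ψ).symm, fun η₁ η₂ σ φ => ?_⟩
  rw [machZehnderU_eq, machZehnderU_eq]
  exact signalState_lossU_onSignal ηdet _ φ
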